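/- Let $r \ge 2$, let $F_r$ be the free group with fixed basis $X_1,\dots,X_r$, let $\mathbb{R}^r_+=\{x\in\mathbb{R}^r : x_i>0 \text{ for all } i\}$ and let $S^r_{\ell_1}=\{v\in\mathbb{R}^r_+ : \sum_i |v_i|=1\}$. An automorphism $\Phi$ of $F_r$ is positive if the reduced word of each $\Phi(X_i)$ contains no inverse of a basis element; its transition matrix is the $r\times r$ matrix whose $(i,j)$ entry is the number of occurrences of $X_j^{\pm1}$ in the reduced word of $\Phi(X_i)$. The Perron–Frobenius eigenvector of a square matrix with strictly positive entries is its eigenvector, for the unique eigenvalue of maximal modulus, that has strictly positive entries with sum $1$. Then the set of Perron–Frobenius eigenvectors of those transition matrices of positive automorphisms of $F_r$ that have strictly positive entries is dense in $S^r_{\ell_1}$. Moreover, the eigenvectors of those among these matrices that are Brun matrices are already dense in $S^r_{\ell_1}$. Here one step of Brun's (unordered) algorithm replaces the coordinate $x_i$ of $x\in\mathbb{R}^r_+$ by $x_i-x_j$, where $i$ is the first index at which $x$ attains its maximum and $j$ is the first index other than $i$ at which the maximum of the coordinates other than $x_i$ is attained; the unfolding matrix $M_{ij}$ of this step has entries $1$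 on the diagonal and in position $(i,j)$, and $0$ elsewhere; and a Brun matrix is a product $M_{i_1j_1}\cdots M_{i_nj_n}$ of the unfolding matrices of the first $n$ successive steps of the algorithm from a starting vector in $\mathbb{R}^r_+$, all of these steps staying in $\mathbb{R}^r_+$. -/

import Mathlib

open Matrix

noncomputable section

/-- The open positive cone `ℝ^r_+` of vectors all of whose entries are strictly positive. -/
def posCone (r : ℕ) : Set (Fin r → ℝ) := {v | ∀ i, 0 < v i}

/-- The vectors of the open positive cone that are unit vectors for the `ℓ¹` norm. -/
def l1Simplex (r : ℕ) : Set (Fin r → ℝ) := {v | v ∈ posCone r ∧ ∑ i, |v i| = 1}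

/-! ### Perron–Frobenius eigenvectors -/

/-- A real matrix is positive if every entry is strictly positive. -/
def IsPositiveMatrix {r : ℕ} (A : Matrix (Fin r) (Fin r) ℝ) : Prop := ∀ i j, 0 < A i j

/-- `ρ` is the unique complex eigenvalue of `A` of maximal modulus (and it is real). -/
def IsPFEigenvalue {r : ℕ} (A : Matrix (Fin r) (Fin r) ℝ) (ρ : ℝ) : Prop :=
  (ρ : ℂ) ∈ spectrum ℂ (A.map Complex.ofReal) ∧
    ∀ z ∈ spectrum ℂ (A.map Complex.ofReal), z ≠ (ρ : ℂ) → ‖z‖ < ‖(ρ : ℂ)‖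

/-- `v` is the Perron–Frobenius eigenvector of the positive matrix `A`: the eigenvector for the
Perron–Frobenius eigenvalue that has strictly positive entries summing to one. -/
structure IsPFEigenvector {r : ℕ} (A : Matrix (Fin r) (Fin r) ℝ) (v : Fin r → ℝ) : Prop where
  matrix_pos : IsPositiveMatrix A
  eigen : ∃ ρ : ℝ, IsPFEigenvalue A ρ ∧ A *ᵥ v = ρ • v
  pos : ∀ i, 0 < v i
  sum_eq_one : ∑ i, v i = 1

/-! ### Automorphisms of the free group and their transition matrices -/

/-- An automorphism of the free group is positive if it sends every element of the fixed basis
to a word in which only the basis elements, and not their inverses, occur. -/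
def IsPositiveAut {r : ℕ} (Φ : MulAut (FreeGroup (Fin r))) : Prop :=
  ∀ i, ∀ a ∈ (Φ (FreeGroup.of i)).toWord, a.2 = true

/-- The transition matrix: its `(i, j)` entry counts how often the reduced word of the image of
the `i`-th basis element passes over the `j`-th basis element, in either direction. -/
def transitionMatrix {r : ℕ} (Φ : MulAut (FreeGroup (Fin r))) : Matrix (Fin r) (Fin r) ℝ :=
  Matrix.of fun i j => ((Φ (FreeGroup.of i)).toWord.countP (fun a => a.1 = j) : ℝ)

/-! ### Brun's unordered algorithm -/

/-- The `(i, j)` folding matrix: ones on the diagonal, `-1` in position `(i, j)`. -/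
def foldingMatrix {r : ℕ} (i j : Fin r) : Matrix (Fin r) (Fin r) ℝ :=
  Matrix.transvection i j (-1)

/-- The `(i, j)` unfolding matrix, inverse (for `i ≠ j`) to the folding matrix:
ones on the diagonal and in position `(i, j)`. -/
def unfoldingMatrix {r : ℕ} (i j : Fin r) : Matrix (Fin r) (Fin r) ℝ :=
  Matrix.transvection i j 1

/-- `i` is the first index at which `x` attains its maximum, and `j` is the first index
different from `i` at which `x` attains its maximum over the indices different from `i`. -/
def IsBrunPair {r : ℕ} (x : Fin r → ℝ) (i j : Fin r) : Prop :=
  IsLeast {a | ∀ k, x k ≤ x a} i ∧ IsLeast {b | b ≠ i ∧ ∀ k, k ≠ i → x k ≤ x b} j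

/-- `BrunProduct x A`: for some `n`, the first `n` steps of Brun's algorithm, started at `x`, stay
in the open positive cone, and `A = M₁ ⋯ Mₙ` is the product of their unfolding matrices. One step
at `x` subtracts the `j`-th coordinate from the `i`-th one, where `(i, j)` is the Brun pair of
`x`; this is multiplication by the folding matrix. -/
inductive BrunProduct {r : ℕ} : (Fin r → ℝ) → Matrix (Fin r) (Fin r) ℝ → Prop
  | nil (x : Fin r → ℝ) (hx : x ∈ posCone r) : BrunProduct x 1
  | cons (x : Fin r → ℝ) (i j : Fin r) (A : Matrix (Fin r) (Fin r) ℝ) (hx : x ∈ posCone r)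
      (hij : IsBrunPair x i j) (hA : BrunProduct (foldingMatrix i j *ᵥ x) A) :
      BrunProduct x (unfoldingMatrix i j * A)

/-- A Brun matrix is a finite product of the unfolding matrices along an orbit of Brun's
algorithm in the open positive cone. -/
def IsBrunMatrix {r : ℕ} (A : Matrix (Fin r) (Fin r) ℝ) : Prop :=
  ∃ x ∈ posCone r, BrunProduct x A

end

/-! If every column of a matrix `A` lies in an open convex cone of positive vectors around `v`, then
`A` is positive and maps positive vectors into that cone, so its Perron–Frobenius eigenvector lies
there too. It remains to find a Brun matrix with this property. Euclid's algorithm on an integer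
vector with direction close to `v` yields a product of unfolding matrices with one column in the
cone (`exists_admissibleProduct_smul_col`). Further factors add large multiples of a column already
in the cone to the others (`AdmissibleProduct.exists_forall_col_mem`). A rule on consecutive
factors, respected by both constructions, makes the product a Brun matrix
(`AdmissibleProduct.isBrunMatrix`). Nielsen automorphisms realize the factors on the free group
(`BrunProduct.exists_positiveAut`). -/

/-! ### Perron–Frobenius theory of positive matrices -/

theorem IsPositiveMatrix.mulVec_pos {r : ℕ} {A : Matrix (Fin r) (Fin r) ℝ}
    (hA : IsPositiveMatrix A) {x : Fin r → ℝ} (hx : ∀ i, 0 ≤ x i) (hx0 : ∃ i, 0 < x i)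
    (i : Fin r) : 0 < (A *ᵥ x) i := by
  obtain ⟨j, hj⟩ := hx0
  exact Finset.sum_pos' (fun k _ => mul_nonneg (hA i k).le (hx k))
    ⟨j, Finset.mem_univ j, mul_pos (hA i j) hj⟩

/-- A maximizer of the Collatz–Wielandt quotient is a positive eigenvector. -/
theorem IsPositiveMatrix.exists_pos_eigenvector {r : ℕ} [NeZero r]
    {A : Matrix (Fin r) (Fin r) ℝ} (hA : IsPositiveMatrix A) :
    ∃ (ρ : ℝ) (v : Fin r → ℝ), 0 < ρ ∧ (∀ i, 0 < v i) ∧ ∑ i, v i = 1 ∧ A *ᵥ v = ρ • v := by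
  set C : ℝ := ∑ i, ∑ j, A i j with hC
  set S : Set (ℝ × (Fin r → ℝ)) :=
    (Set.Icc 0 C ×ˢ stdSimplex ℝ (Fin r)) ∩ {p | ∀ i, p.1 * p.2 i ≤ (A *ᵥ p.2) i} with hS
  have mem_S : ∀ ρ x, 0 ≤ ρ → x ∈ stdSimplex ℝ (Fin r) → (∀ i, ρ * x i ≤ (A *ᵥ x) i) →
      (ρ, x) ∈ S := by
    intro ρ x hρ hx h
    refine ⟨⟨⟨hρ, ?_⟩, hx⟩, h⟩
    -- Summing the coordinate inequalities bounds `ρ`; this makes `S` compact.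
    calc ρ = ∑ i, ρ * x i := by rw [← Finset.mul_sum, hx.2, mul_one]
      _ ≤ ∑ i, (A *ᵥ x) i := Finset.sum_le_sum fun i _ => h i
      _ ≤ C := Finset.sum_le_sum fun i _ => by
        rw [mulVec, dotProduct]
        refine Finset.sum_le_sum fun j _ => ?_
        have hj : x j ≤ 1 := by
          rw [← hx.2]
          exact Finset.single_le_sum (fun k _ => hx.1 k) (Finset.mem_univ j)
        exact mul_le_of_le_one_right (hA i j).le hj
  have closed : IsClosed {p : ℝ × (Fin r → ℝ) | ∀ i, p.1 * p.2 i ≤ (A *ᵥ p.2) i} := by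
    simp only [Set.ofPred_forall]
    refine isClosed_iInter fun i => isClosed_le (by fun_prop) ?_
    simp only [mulVec, dotProduct]
    fun_prop
  have compact : IsCompact S :=
    (isCompact_Icc.prod (isCompact_stdSimplex ℝ (Fin r))).inter_right closed
  have nonempty : S.Nonempty := by
    refine ⟨(0, Pi.single 0 1), mem_S 0 _ le_rfl (single_mem_stdSimplex ℝ 0) fun i => ?_⟩
    simpa using (hA i 0).le
  obtain ⟨⟨ρ, x⟩, hp, hmax⟩ := compact.exists_isMaxOn nonempty continuous_fst.continuousOn
  obtain ⟨⟨⟨hρ0, -⟩, hx⟩, hle⟩ := hp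
  simp only [Set.mem_ofPred_eq] at hρ0 hx hle
  have exists_pos : ∃ i, 0 < x i := by
    by_contra! h
    have : ∑ i, x i ≤ 0 := Finset.sum_nonpos fun i _ => h i
    linarith [hx.2]
  have hAx := hA.mulVec_pos hx.1 exists_pos
  have heq : A *ᵥ x = ρ • x := by
    by_contra hne
    have hgap : ∃ i, 0 < (A *ᵥ x - ρ • x) i := by
      by_contra! h
      refine hne (funext fun i => le_antisymm ?_ (hle i))
      simpa using h i
    set y := A *ᵥ x with hy
    -- `A` maps the nonzero nonnegative vector `y - ρ • x` to a strictly positive one, so `y` admits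
    -- a quotient larger than `ρ`.
    have hAy : ∀ i, ρ * y i < (A *ᵥ y) i := by
      intro i
      have := hA.mulVec_pos (x := y - ρ • x) (fun k => by simpa using hle k) hgap i
      rw [mulVec_sub, mulVec_smul, ← hy] at this
      simpa using this
    obtain ⟨k, -, hk⟩ := Finset.exists_min_image Finset.univ (fun i => (A *ᵥ y) i / y i)
      Finset.univ_nonempty
    have hρk : ρ < (A *ᵥ y) k / y k := (lt_div_iff₀ (hAx k)).2 (hAy k)
    have hsum : 0 < ∑ i, y i := Finset.sum_pos (fun i _ => hAx i) Finset.univ_nonempty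
    have hmem := mem_S ((A *ᵥ y) k / y k) ((∑ i, y i)⁻¹ • y) (hρ0.trans hρk.le)
      ⟨fun i => mul_nonneg (inv_nonneg.2 hsum.le) (hAx i).le, by
        simp only [Pi.smul_apply, smul_eq_mul]
        rw [← Finset.mul_sum, inv_mul_cancel₀ hsum.ne']⟩ (fun i => by
        have h1 := (le_div_iff₀ (hAx i)).1 (hk i (Finset.mem_univ i))
        rw [mulVec_smul]
        simp only [Pi.smul_apply, smul_eq_mul]
        rw [mul_left_comm]
        exact mul_le_mul_of_nonneg_left h1 (inv_nonneg.2 hsum.le))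
    exact absurd (hmax hmem) (not_le.2 hρk)
  have hprod : ∀ i, 0 < ρ * x i := fun i => by simpa [heq] using hAx i
  have hρ : 0 < ρ := hρ0.lt_of_ne' (left_ne_zero_of_mul (hprod 0).ne')
  exact ⟨ρ, x, hρ, fun i => pos_of_mul_pos_right (hprod i) hρ0, hx.2, heq⟩

/-- Complex eigenvalues of a nonnegative matrix are dominated by the eigenvalue of a positive
eigenvector. -/
theorem norm_eigenvalue_le_of_pos_eigenvector {r : ℕ} {B : Matrix (Fin r) (Fin r) ℝ}
    (hB : ∀ i j, 0 ≤ B i j) {σ : ℝ} {v : Fin r → ℝ} (hv : ∀ i, 0 < v i) (hBv : B *ᵥ v = σ • v)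
    {μ : ℂ} {w : Fin r → ℂ} (hw : w ≠ 0) (hBw : B.map Complex.ofReal *ᵥ w = μ • w) :
    ‖μ‖ ≤ σ := by
  obtain ⟨l, hl⟩ := Function.ne_iff.1 hw
  obtain ⟨i, -, hi⟩ := Finset.exists_max_image Finset.univ (fun i => ‖w i‖ / v i)
    ⟨l, Finset.mem_univ l⟩
  set c := ‖w i‖ / v i with hc
  have hcl : 0 < c := (div_pos (norm_pos_iff.2 hl) (hv l)).trans_le (hi l (Finset.mem_univ l))
  have hwc : ∀ j, ‖w j‖ ≤ c * v j := fun j => (div_le_iff₀ (hv j)).1 (hi j (Finset.mem_univ j))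
  have hwi : ‖w i‖ = c * v i := (div_mul_cancel₀ _ (hv i).ne').symm
  have h1 : ‖μ‖ * (c * v i) ≤ σ * (c * v i) :=
    calc ‖μ‖ * (c * v i) = ‖∑ j, (B i j : ℂ) * w j‖ := by
          rw [← hwi, ← norm_mul]
          exact congrArg norm (congrFun hBw i).symm
      _ ≤ ∑ j, B i j * (c * v j) := norm_sum_le_of_le _ fun j _ => by
          rw [norm_mul, Complex.norm_real, Real.norm_of_nonneg (hB i j)]
          exact mul_le_mul_of_nonneg_left (hwc j) (hB i j)
      _ = c * (B *ᵥ v) i := by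
          rw [mulVec, dotProduct, Finset.mul_sum]
          exact Finset.sum_congr rfl fun j _ => by ring
      _ = σ * (c * v i) := by rw [hBv]; simp; ring
  exact le_of_mul_le_mul_right h1 (mul_pos hcl (hv i))

/-- The disc of centre `ε` and radius `ρ - ε` touches the circle of radius `ρ` from inside, only at
`ρ`. -/
theorem eq_of_norm_sub_le_of_le_norm {ε ρ : ℝ} (hε : 0 < ε) {z : ℂ}
    (h : ‖z - ε‖ ≤ ρ - ε) (hz : ρ ≤ ‖z‖) : z = ρ := by
  have h0 : 0 ≤ ρ - ε := (norm_nonneg _).trans h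
  have h1 : ‖z - ε‖ ^ 2 ≤ (ρ - ε) ^ 2 := pow_le_pow_left₀ (norm_nonneg _) h 2
  have h2 : ρ ^ 2 ≤ ‖z‖ ^ 2 := pow_le_pow_left₀ (by linarith) hz 2
  rw [← Complex.normSq_eq_norm_sq, Complex.normSq_apply] at h1 h2
  simp only [Complex.sub_re, Complex.ofReal_re, Complex.sub_im, Complex.ofReal_im, sub_zero]
    at h1
  have hre : ρ ≤ z.re := by
    by_contra! hlt
    nlinarith [mul_pos hε (sub_pos.2 hlt)]
  have him : z.im = 0 := by
    have : z.im * z.im ≤ 0 := by nlinarith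
    exact mul_self_eq_zero.1 (le_antisymm this (mul_self_nonneg _))
  have hre' : z.re ≤ ρ := by
    have := Complex.abs_re_le_norm (z - ε)
    simp only [Complex.sub_re, Complex.ofReal_re] at this
    linarith [le_abs_self (z.re - ε)]
  exact Complex.ext (by simpa using le_antisymm hre' hre) (by simpa using him)

theorem mem_spectrum_matrix_iff {r : ℕ} {A : Matrix (Fin r) (Fin r) ℂ} {μ : ℂ} :
    μ ∈ spectrum ℂ A ↔ ∃ w : Fin r → ℂ, w ≠ 0 ∧ A *ᵥ w = μ • w := by
  rw [← spectrum_toLin', ← Module.End.hasEigenvalue_iff_mem_spectrum]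
  constructor
  · intro h
    obtain ⟨w, hw⟩ := h.exists_hasEigenvector
    exact ⟨w, hw.2, by simpa using hw.apply_eq_smul⟩
  · rintro ⟨w, hw, h⟩
    exact Module.End.hasEigenvalue_of_hasEigenvector
      (Module.End.hasEigenvector_iff.2 ⟨Module.End.mem_eigenspace_iff.2 (by simpa using h), hw⟩)

/-- The eigenvalue of a positive eigenvector of a positive matrix is its Perron–Frobenius
eigenvalue. -/
theorem IsPositiveMatrix.isPFEigenvalue {r : ℕ} [NeZero r] {A : Matrix (Fin r) (Fin r) ℝ}
    (hA : IsPositiveMatrix A) {ρ : ℝ} (hρ : 0 < ρ) {v : Fin r → ℝ} (hv : ∀ i, 0 < v i)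
    (hAv : A *ᵥ v = ρ • v) : IsPFEigenvalue A ρ := by
  refine ⟨mem_spectrum_matrix_iff.2 ⟨fun i => (v i : ℂ), ?_, ?_⟩, fun z hz hne => ?_⟩
  · exact Function.ne_iff.2 ⟨0, by simpa using (hv 0).ne'⟩
  · funext i
    have := congrArg Complex.ofReal (congrFun hAv i)
    simpa [mulVec, dotProduct] using this
  · obtain ⟨w, hw, hAw⟩ := mem_spectrum_matrix_iff.1 hz
    -- Subtracting the least diagonal entry times the identity keeps the matrix nonnegative and
    -- shifts all eigenvalues by that entry, which confines `z` to the tangent disc.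
    obtain ⟨k, -, hk⟩ := Finset.exists_min_image Finset.univ (fun i => A i i)
      Finset.univ_nonempty
    rw [Complex.norm_real, Real.norm_of_nonneg hρ.le]
    by_contra! hle
    refine hne (eq_of_norm_sub_le_of_le_norm (hA k k) ?_ hle)
    refine norm_eigenvalue_le_of_pos_eigenvector (B := A - A k k • 1) (fun i j => ?_) hv ?_ hw ?_
    · rcases eq_or_ne i j with rfl | hij
      · simpa using hk i (Finset.mem_univ i)
      · simpa [one_apply_ne hij] using (hA i j).le
    · rw [sub_mulVec, hAv, smul_mulVec, one_mulVec, sub_smul]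
    · have : (A - A k k • 1).map Complex.ofReal =
          A.map Complex.ofReal - (A k k : ℂ) • (1 : Matrix (Fin r) (Fin r) ℂ) := by
        ext i j
        simp [one_apply, apply_ite Complex.ofReal]
      rw [this, sub_mulVec, hAw, smul_mulVec, one_mulVec, sub_smul]

theorem IsPositiveMatrix.exists_isPFEigenvector {r : ℕ} [NeZero r]
    {A : Matrix (Fin r) (Fin r) ℝ} (hA : IsPositiveMatrix A) :
    ∃ v, IsPFEigenvector A v ∧ ∃ ρ : ℝ, 0 < ρ ∧ A *ᵥ v = ρ • v := by
  obtain ⟨ρ, v, hρ, hv, hsum, hAv⟩ := hA.exists_pos_eigenvector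
  exact ⟨v, ⟨hA, ⟨ρ, hA.isPFEigenvalue hρ hv hAv, hAv⟩, hv, hsum⟩, ρ, hρ, hAv⟩

/-! ### Brun matrices are transition matrices of positive automorphisms -/

theorem FreeGroup.toWord_mul_of_forall_snd {α : Type*} [DecidableEq α] {x y : FreeGroup α}
    (hx : ∀ a ∈ x.toWord, a.2 = true) (hy : ∀ a ∈ y.toWord, a.2 = true) :
    (x * y).toWord = x.toWord ++ y.toWord := by
  rw [FreeGroup.toWord_mul]
  refine FreeGroup.IsReduced.reduce_eq (List.Pairwise.isChain ?_)
  refine List.pairwise_of_forall_mem_list fun a ha b hb _ => ?_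
  have h : ∀ c ∈ x.toWord ++ y.toWord, c.2 = true := fun c hc =>
    (List.mem_append.1 hc).elim (hx c) (hy c)
  rw [h a ha, h b hb]

/-- The Nielsen automorphism sending the `i`-th basis element to its product with the `j`-th one
and fixing all other basis elements. -/
def nielsenAut {r : ℕ} (i j : Fin r) (hij : i ≠ j) : MulAut (FreeGroup (Fin r)) :=
  MonoidHom.toMulEquiv
    (FreeGroup.lift (Function.update FreeGroup.of i (FreeGroup.of i * FreeGroup.of j)))
    (FreeGroup.lift (Function.update FreeGroup.of i (FreeGroup.of i * (FreeGroup.of j)⁻¹)))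
    (by
      ext k
      rcases eq_or_ne k i with rfl | hk
      · simp [Function.update_of_ne hij.symm]
      · simp [Function.update_of_ne hk])
    (by
      ext k
      rcases eq_or_ne k i with rfl | hk
      · simp [Function.update_of_ne hij.symm]
      · simp [Function.update_of_ne hk])

theorem nielsenAut_of_same {r : ℕ} {i j : Fin r} (hij : i ≠ j) :
    nielsenAut i j hij (FreeGroup.of i) = FreeGroup.of i * FreeGroup.of j := by
  simp [nielsenAut]

theorem nielsenAut_of_ne {r : ℕ} {i j k : Fin r} (hij : i ≠ j) (hk : k ≠ i) :
    nielsenAut i j hij (FreeGroup.of k) = FreeGroup.of k := by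
  simp [nielsenAut, Function.update_of_ne hk]

theorem toWord_mul_nielsenAut_of_same {r : ℕ} {Φ : MulAut (FreeGroup (Fin r))}
    (hΦ : IsPositiveAut Φ) {i j : Fin r} (hij : i ≠ j) :
    ((Φ * nielsenAut i j hij) (FreeGroup.of i)).toWord =
      (Φ (FreeGroup.of i)).toWord ++ (Φ (FreeGroup.of j)).toWord := by
  rw [MulAut.mul_apply, nielsenAut_of_same, map_mul,
    FreeGroup.toWord_mul_of_forall_snd (hΦ i) (hΦ j)]

theorem IsPositiveAut.mul_nielsenAut {r : ℕ} {Φ : MulAut (FreeGroup (Fin r))}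
    (hΦ : IsPositiveAut Φ) {i j : Fin r} (hij : i ≠ j) :
    IsPositiveAut (Φ * nielsenAut i j hij) := by
  intro k a ha
  rcases eq_or_ne k i with rfl | hk
  · rw [toWord_mul_nielsenAut_of_same hΦ] at ha
    exact (List.mem_append.1 ha).elim (hΦ _ a) (hΦ _ a)
  · rw [MulAut.mul_apply, nielsenAut_of_ne hij hk] at ha
    exact hΦ k a ha

/-- The Nielsen automorphism acts first, and positivity excludes cancellation: row `j` is added to
row `i`, which is multiplication on the left. -/
theorem transitionMatrix_mul_nielsenAut {r : ℕ} {Φ : MulAut (FreeGroup (Fin r))}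
    (hΦ : IsPositiveAut Φ) {i j : Fin r} (hij : i ≠ j) :
    transitionMatrix (Φ * nielsenAut i j hij) = unfoldingMatrix i j * transitionMatrix Φ := by
  ext k l
  rcases eq_or_ne k i with rfl | hk
  · rw [unfoldingMatrix, transvection_mul_apply_same]
    simp only [transitionMatrix, of_apply, toWord_mul_nielsenAut_of_same hΦ, List.countP_append]
    push_cast
    ring
  · rw [unfoldingMatrix, transvection_mul_apply_of_ne _ _ _ _ hk]
    simp only [transitionMatrix, of_apply, MulAut.mul_apply, nielsenAut_of_ne hij hk]

theorem BrunProduct.exists_positiveAut {r : ℕ} {x : Fin r → ℝ} {A : Matrix (Fin r) (Fin r) ℝ}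
    (h : BrunProduct x A) :
    ∃ Φ : MulAut (FreeGroup (Fin r)), IsPositiveAut Φ ∧ transitionMatrix Φ = A := by
  induction h with
  | nil x hx =>
    refine ⟨1, fun i a ha => ?_, ?_⟩
    · rw [MulAut.one_apply, FreeGroup.toWord_of, List.mem_singleton] at ha
      rw [ha]
    · ext i j
      simp [transitionMatrix, FreeGroup.toWord_of, one_apply, List.countP_cons]
  | cons x i j A hx hij hA ih =>
    obtain ⟨Φ, hΦ, rfl⟩ := ih
    have hne : i ≠ j := hij.2.1.1.symm
    exact ⟨Φ * nielsenAut i j hne, hΦ.mul_nielsenAut hne, transitionMatrix_mul_nielsenAut hΦ hne⟩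

/-! ### Admissible products of unfolding matrices -/

theorem transvection_mulVec_same {r : ℕ} (i j : Fin r) (c : ℝ) (z : Fin r → ℝ) :
    (transvection i j c *ᵥ z) i = z i + c * z j := by
  simp [transvection, add_mulVec, single_mulVec]

theorem transvection_mulVec_of_ne {r : ℕ} {i k : Fin r} (hk : k ≠ i) (j : Fin r) (c : ℝ)
    (z : Fin r → ℝ) : (transvection i j c *ᵥ z) k = z k := by
  simp [transvection, add_mulVec, single_mulVec, hk]

/-- `AdmissibleProduct A i j`: `A` is a product of unfolding matrices, each factor `(a, b)` of
which is followed by itself or by a factor `(b, c)`, and `(i, j)` is the last factor (for the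
empty product, an arbitrary pair of distinct indices). -/
inductive AdmissibleProduct {r : ℕ} : Matrix (Fin r) (Fin r) ℝ → Fin r → Fin r → Prop
  | one {i j : Fin r} (hij : i ≠ j) : AdmissibleProduct 1 i j
  | same {A : Matrix (Fin r) (Fin r) ℝ} {i j : Fin r} (h : AdmissibleProduct A i j) :
      AdmissibleProduct (A * unfoldingMatrix i j) i j
  | next {A : Matrix (Fin r) (Fin r) ℝ} {i j k : Fin r} (h : AdmissibleProduct A i j)
      (hjk : j ≠ k) : AdmissibleProduct (A * unfoldingMatrix j k) j k

theorem AdmissibleProduct.ne {r : ℕ} {A : Matrix (Fin r) (Fin r) ℝ} {i j : Fin r}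
    (h : AdmissibleProduct A i j) : i ≠ j := by
  induction h with
  | one hij => exact hij
  | same _ ih => exact ih
  | next _ hjk _ => exact hjk

theorem AdmissibleProduct.next_transvection {r : ℕ} {A : Matrix (Fin r) (Fin r) ℝ}
    {i j k : Fin r} (h : AdmissibleProduct A i j) (hjk : j ≠ k) (m : ℕ) :
    AdmissibleProduct (A * transvection j k ((m : ℝ) + 1)) j k := by
  induction m with
  | zero => simpa [unfoldingMatrix] using h.next hjk
  | succ m ih =>
    have := ih.same
    rwa [unfoldingMatrix, Matrix.mul_assoc, transvection_mul_transvection_same _ _ hjk,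
      ← Nat.cast_succ] at this

/-- Strict inequalities exclude ties, so the first-index conventions play no role. -/
theorem IsBrunPair.of_lt {r : ℕ} {x : Fin r → ℝ} {i j : Fin r} (hij : i ≠ j) (h : x j < x i)
    (hl : ∀ l, l ≠ i → l ≠ j → x l < x j) : IsBrunPair x i j := by
  have hj : ∀ k, k ≠ i → x k ≤ x j := fun k hk => by
    rcases eq_or_ne k j with rfl | hkj
    exacts [le_rfl, (hl k hk hkj).le]
  refine ⟨⟨fun k => ?_, fun a ha => ?_⟩, ⟨⟨hij.symm, hj⟩, fun b hb => ?_⟩⟩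
  · rcases eq_or_ne k i with rfl | hk
    exacts [le_rfl, (hj k hk).trans h.le]
  · by_contra hai
    have hne : a ≠ i := fun e => hai e.ge
    exact absurd (ha i) (not_le.2 ((hj a hne).trans_lt h))
  · by_contra hbj
    have hne : b ≠ j := fun e => hbj e.ge
    exact absurd (hb.2 j hij.symm) (not_le.2 (hl b hb.1 hne))

theorem foldingMatrix_mulVec_unfoldingMatrix_mulVec {r : ℕ} {i j : Fin r} (hij : i ≠ j)
    (z : Fin r → ℝ) : foldingMatrix i j *ᵥ (unfoldingMatrix i j *ᵥ z) = z := by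
  rw [mulVec_mulVec, foldingMatrix, unfoldingMatrix, transvection_mul_transvection_same _ _ hij]
  simp

theorem unfoldingMatrix_mulVec_mem_posCone {r : ℕ} {z : Fin r → ℝ} (hz : z ∈ posCone r)
    (i j : Fin r) : unfoldingMatrix i j *ᵥ z ∈ posCone r := by
  intro k
  rcases eq_or_ne k i with rfl | hk
  · rw [unfoldingMatrix, transvection_mulVec_same, one_mul]
    exact add_pos (hz k) (hz j)
  · rw [unfoldingMatrix, transvection_mulVec_of_ne hk]
    exact hz k

/-- One unfolding step is an inverse step of Brun's algorithm. -/
theorem BrunProduct.unfold {r : ℕ} {i j : Fin r} (hij : i ≠ j) {z : Fin r → ℝ}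
    (hz : z ∈ posCone r) (hl : ∀ l, l ≠ i → l ≠ j → z l < z j)
    {B : Matrix (Fin r) (Fin r) ℝ} (hB : BrunProduct z B) :
    BrunProduct (unfoldingMatrix i j *ᵥ z) (unfoldingMatrix i j * B) := by
  refine .cons _ i j B (unfoldingMatrix_mulVec_mem_posCone hz i j) (.of_lt hij ?_ ?_) ?_
  · rw [unfoldingMatrix, transvection_mulVec_same, transvection_mulVec_of_ne hij.symm, one_mul]
    exact lt_add_of_pos_left _ (hz i)
  · intro l hli hlj
    rw [unfoldingMatrix, transvection_mulVec_of_ne hli, transvection_mulVec_of_ne hij.symm]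
    exact hl l hli hlj
  · rwa [foldingMatrix_mulVec_unfoldingMatrix_mulVec hij]

/-- Unfolding by `(j, k)` makes entry `j` the strict maximum. This is what a preceding factor `(i,
j)` requires; a preceding `(j, k)` only needs entry `k` to keep dominating the rest. -/
theorem AdmissibleProduct.brunProduct_mul {r : ℕ} {A : Matrix (Fin r) (Fin r) ℝ} {i j : Fin r}
    (h : AdmissibleProduct A i j) {z : Fin r → ℝ} (hz : z ∈ posCone r)
    (hl : ∀ l, l ≠ i → l ≠ j → z l < z j) {B : Matrix (Fin r) (Fin r) ℝ}
    (hB : BrunProduct z B) : BrunProduct (A *ᵥ z) (A * B) := by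
  induction h generalizing z B with
  | one => simpa using hB
  | same h ih =>
    rw [← mulVec_mulVec, Matrix.mul_assoc]
    refine ih (unfoldingMatrix_mulVec_mem_posCone hz _ _) (fun l hli hlj => ?_)
      (hB.unfold h.ne hz hl)
    rw [unfoldingMatrix, transvection_mulVec_of_ne hli, transvection_mulVec_of_ne h.ne.symm]
    exact hl l hli hlj
  | @next A i j k h hjk ih =>
    rw [← mulVec_mulVec, Matrix.mul_assoc]
    refine ih (unfoldingMatrix_mulVec_mem_posCone hz _ _) (fun l hli hlj => ?_)
      (hB.unfold hjk hz hl)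
    rw [unfoldingMatrix, transvection_mulVec_of_ne hlj, transvection_mulVec_same, one_mul]
    rcases eq_or_ne l k with rfl | hlk
    · exact lt_add_of_pos_left _ (hz j)
    · exact (hl l hlj hlk).trans (lt_add_of_pos_left _ (hz j))

theorem AdmissibleProduct.isBrunMatrix {r : ℕ} {A : Matrix (Fin r) (Fin r) ℝ} {i j : Fin r}
    (h : AdmissibleProduct A i j) : IsBrunMatrix A := by
  set z : Fin r → ℝ := Function.update 1 j 2 with hz
  have hpos : z ∈ posCone r := fun k => by
    rcases eq_or_ne k j with rfl | hk
    · simp [hz]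
    · simp [hz, hk]
  have hB := h.brunProduct_mul hpos (fun l _ hlj => by simp [hz, hlj]) (.nil z hpos)
  rw [mul_one] at hB
  refine ⟨A *ᵥ z, ?_, hB⟩
  cases hB <;> assumption

/-! ### Euclid's algorithm reaches every direction of natural vectors -/

/-- While entry `i` exceeds entry `j`, the pair `(i, j)` is repeated; then `j` is maximal and the
next pair is `(j, k)`, with `k` a largest other entry. Zeros and ties may occur, so only
admissibility of the factors is tracked, not a Brun orbit of `y`. -/
theorem AdmissibleProduct.exists_smul_col {r : ℕ} {A : Matrix (Fin r) (Fin r) ℝ} {i j : Fin r}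
    (h : AdmissibleProduct A i j) {y : Fin r → ℕ} (hj : 0 < y j)
    (hl : ∀ l, l ≠ i → y l ≤ y j) :
    ∃ (B : Matrix (Fin r) (Fin r) ℝ) (a b : Fin r) (d : ℝ), AdmissibleProduct B a b ∧ 0 < d ∧
      A *ᵥ (fun l => (y l : ℝ)) = d • B.col b := by
  induction hn : ∑ l, y l using Nat.strong_induction_on generalizing A i j y with
  | _ n ih =>
  /- Subtract `y b` from `y a`, given that `(a, b)` may follow. -/
  have step : ∀ a b, AdmissibleProduct (A * unfoldingMatrix a b) a b → 0 < y b → y b ≤ y a →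
      (∀ l, l ≠ a → y l ≤ y b) → ∃ (B : Matrix (Fin r) (Fin r) ℝ) (a b : Fin r) (d : ℝ),
        AdmissibleProduct B a b ∧ 0 < d ∧ A *ᵥ (fun l => (y l : ℝ)) = d • B.col b := by
    intro a b hab hb hba hmax
    have hne := hab.ne
    obtain ⟨B, a', b', d, hB, hd, heq⟩ := ih (∑ l, Function.update y a (y a - y b) l) (by
        rw [← hn]
        refine Finset.sum_lt_sum (fun l _ => ?_) ⟨a, Finset.mem_univ a, ?_⟩
        · rcases eq_or_ne l a with rfl | hla
          · simp
          · simp [hla]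
        · simp only [Function.update_self]
          omega) hab (y := Function.update y a (y a - y b)) (by simpa [hne.symm] using hb)
        (fun l hla => by simpa [hne.symm, hla] using hmax l hla) rfl
    refine ⟨B, a', b', d, hB, hd, heq ▸ ?_⟩
    rw [← mulVec_mulVec]
    congr 1
    funext l
    rcases eq_or_ne l a with rfl | hla
    · rw [unfoldingMatrix, transvection_mulVec_same]
      simp [hne.symm, Nat.cast_sub hba]
    · rw [unfoldingMatrix, transvection_mulVec_of_ne hla]
      simp [hla]
  rcases lt_or_ge (y j) (y i) with hij | hij
  · exact step i j h.same hj hij.le hl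
  have hmax : ∀ l, y l ≤ y j := fun l => by
    rcases eq_or_ne l i with rfl | hli
    exacts [hij, hl l hli]
  by_cases hzero : ∀ l, l ≠ j → y l = 0
  · refine ⟨A, i, j, y j, h, by exact_mod_cast hj, ?_⟩
    have : (fun l => (y l : ℝ)) = (y j : ℝ) • Pi.single j 1 := by
      funext l
      rcases eq_or_ne l j with rfl | hlj
      · simp
      · simp [hlj, hzero l hlj]
    rw [this, mulVec_smul, mulVec_single_one]
  · push Not at hzero
    obtain ⟨l, hlj, hl0⟩ := hzero
    obtain ⟨k, hk, hkmax⟩ := Finset.exists_max_image (Finset.univ.erase j) y ⟨l, by simp [hlj]⟩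
    have hkmax' : ∀ l, l ≠ j → y l ≤ y k := fun l hlj => hkmax l (by simp [hlj])
    exact step j k (h.next (Finset.ne_of_mem_erase hk).symm)
      ((Nat.pos_of_ne_zero hl0).trans_le (hkmax' l hlj)) (hmax k) hkmax'

theorem exists_admissibleProduct_smul_col {r : ℕ} (hr : 2 ≤ r) {y : Fin r → ℕ}
    (hy : ∃ l, 0 < y l) :
    ∃ (B : Matrix (Fin r) (Fin r) ℝ) (a b : Fin r) (d : ℝ), AdmissibleProduct B a b ∧ 0 < d ∧
      (fun l => (y l : ℝ)) = d • B.col b := by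
  obtain ⟨l, hl⟩ := hy
  obtain ⟨j, -, hj⟩ := Finset.exists_max_image Finset.univ y ⟨l, Finset.mem_univ l⟩
  have : Nontrivial (Fin r) := Fin.nontrivial_iff_two_le.2 hr
  obtain ⟨i, hij⟩ := exists_ne j
  simpa using (AdmissibleProduct.one hij).exists_smul_col (y := y)
    (hl.trans_le (hj l (Finset.mem_univ l))) (fun k _ => hj k (Finset.mem_univ k))

/-! ### Pulling all columns into an open convex cone -/

/-- After division by `m + 1` the vector tends to `c`. -/
theorem IsOpen.exists_add_smul_mem {r : ℕ} {U : Set (Fin r → ℝ)} (hU : IsOpen U)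
    (hsmul : ∀ t : ℝ, 0 < t → ∀ u ∈ U, t • u ∈ U) {c : Fin r → ℝ} (hc : c ∈ U)
    (d : Fin r → ℝ) : ∃ m : ℕ, d + ((m : ℝ) + 1) • c ∈ U := by
  have hlim : Filter.Tendsto (fun m : ℕ => (1 / ((m : ℝ) + 1)) • d + c) Filter.atTop (nhds c) := by
    simpa using (tendsto_one_div_add_atTop_nhds_zero_nat (𝕜 := ℝ)).smul_const d |>.add_const c
  obtain ⟨m, hm⟩ := (hlim.eventually (hU.mem_nhds hc)).exists
  have hm0 : (0 : ℝ) < (m : ℝ) + 1 := by positivity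
  refine ⟨m, ?_⟩
  have := hsmul _ hm0 _ hm
  rwa [smul_add, smul_smul, mul_one_div_cancel hm0.ne', one_smul] at this

/-- `T` holds the columns still to be treated. The factor `(j, k)`, repeated, adds multiples of
column `j` to column `k`; then `k` is the new last index, its column is in `U`, and the process
continues from it. -/
theorem AdmissibleProduct.exists_forall_col_mem {r : ℕ} {U : Set (Fin r → ℝ)} (hU : IsOpen U)
    (hsmul : ∀ t : ℝ, 0 < t → ∀ u ∈ U, t • u ∈ U) {A : Matrix (Fin r) (Fin r) ℝ} {i j : Fin r}
    (h : AdmissibleProduct A i j) (T : Finset (Fin r)) (hT : ∀ k ∉ T, A.col k ∈ U)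
    (hj : A.col j ∈ U) :
    ∃ (B : Matrix (Fin r) (Fin r) ℝ) (a b : Fin r), AdmissibleProduct B a b ∧
      ∀ k, B.col k ∈ U := by
  induction T using Finset.induction_on generalizing A i j with
  | empty => exact ⟨A, i, j, h, fun k => hT k (Finset.notMem_empty k)⟩
  | insert k T hk ih =>
    rcases eq_or_ne j k with rfl | hjk
    · refine ih h (fun l hl => ?_) hj
      rcases eq_or_ne l j with rfl | hlj
      exacts [hj, hT l (by simp [hl, hlj])]
    · obtain ⟨m, hm⟩ := hU.exists_add_smul_mem hsmul hj (A.col k)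
      have hcol : (A * transvection j k ((m : ℝ) + 1)).col k ∈ U := by
        convert hm using 1
        funext a
        simp
      refine ih (h.next_transvection hjk m) (fun l hl => ?_) hcol
      rcases eq_or_ne l k with rfl | hlk
      · exact hcol
      · convert hT l (by simp [hl, hlk]) using 1
        funext a
        simp [hlk]

/-! ### Density -/

/-- The cone of positive vectors whose `ℓ¹` normalization is closer than `ε` to `v`. -/
def coneAround {r : ℕ} (v : Fin r → ℝ) (ε : ℝ) : Set (Fin r → ℝ) :=
  {u | ∀ i, 0 < u i ∧ |u i - (∑ k, u k) * v i| < ε * ∑ k, u k}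

theorem isOpen_coneAround {r : ℕ} (v : Fin r → ℝ) (ε : ℝ) : IsOpen (coneAround v ε) := by
  simp only [coneAround, Set.ofPred_forall]
  refine isOpen_iInter_of_finite fun i => ?_
  have h1 : IsOpen {u : Fin r → ℝ | 0 < u i} := isOpen_lt (by fun_prop) (by fun_prop)
  have h2 : IsOpen {u : Fin r → ℝ | |u i - (∑ k, u k) * v i| < ε * ∑ k, u k} :=
    isOpen_lt (by fun_prop) (by fun_prop)
  exact h1.inter h2

theorem smul_mem_coneAround {r : ℕ} {v : Fin r → ℝ} {ε : ℝ} (t : ℝ) (ht : 0 < t)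
    (u : Fin r → ℝ) (hu : u ∈ coneAround v ε) : t • u ∈ coneAround v ε := by
  intro i
  simp only [Pi.smul_apply, smul_eq_mul, ← Finset.mul_sum]
  refine ⟨mul_pos ht (hu i).1, ?_⟩
  rw [mul_assoc, ← mul_sub, abs_mul, abs_of_pos ht, mul_left_comm]
  exact mul_lt_mul_of_pos_left (hu i).2 ht

theorem add_mem_coneAround {r : ℕ} {v : Fin r → ℝ} {ε : ℝ} {u w : Fin r → ℝ}
    (hu : u ∈ coneAround v ε) (hw : w ∈ coneAround v ε) : u + w ∈ coneAround v ε := by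
  intro i
  simp only [Pi.add_apply, Finset.sum_add_distrib]
  refine ⟨add_pos (hu i).1 (hw i).1, ?_⟩
  rw [add_mul, add_sub_add_comm, mul_add]
  exact (abs_add_le _ _).trans_lt (add_lt_add (hu i).2 (hw i).2)

theorem mulVec_mem_coneAround {r : ℕ} [NeZero r] {v : Fin r → ℝ} {ε : ℝ}
    {A : Matrix (Fin r) (Fin r) ℝ} (hA : ∀ k, A.col k ∈ coneAround v ε) {x : Fin r → ℝ}
    (hx : ∀ i, 0 < x i) : A *ᵥ x ∈ coneAround v ε := by
  have : A *ᵥ x = ∑ k, x k • A.col k := by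
    funext a
    simp [mulVec, dotProduct, mul_comm]
  rw [this]
  exact Finset.sum_induction_nonempty _ (· ∈ coneAround v ε) (fun _ _ => add_mem_coneAround)
    Finset.univ_nonempty fun k _ => smul_mem_coneAround _ (hx k) _ (hA k)

theorem exists_natCast_mem_coneAround {r : ℕ} {v : Fin r → ℝ} (hv : v ∈ l1Simplex r) {ε : ℝ}
    (hε : 0 < ε) : ∃ y : Fin r → ℕ, (fun i => (y i : ℝ)) ∈ coneAround v ε := by
  have hpos : ∀ i, 0 < v i := hv.1
  have hsum : ∑ i, v i = 1 := by
    rw [← hv.2]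
    exact Finset.sum_congr rfl fun i _ => (abs_of_pos (hpos i)).symm
  -- Ceilings keep the entries positive. Rounding costs at most `1` in an entry and `r` in the sum,
  -- hence the bound `r + 1 < ε * N`.
  obtain ⟨N, hN⟩ := exists_nat_gt ((r + 1) / ε)
  have hN0 : (0 : ℝ) < N := lt_of_le_of_lt (by positivity) hN
  have hNε : r + 1 < ε * N := by rwa [div_lt_iff₀' hε] at hN
  refine ⟨fun i => ⌈N * v i⌉₊, fun i => ⟨?_, ?_⟩⟩
  · exact Nat.cast_pos.2 (Nat.ceil_pos.2 (mul_pos hN0 (hpos i)))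
  have hlow : (N : ℝ) ≤ ∑ k, (⌈N * v k⌉₊ : ℝ) :=
    calc (N : ℝ) = ∑ k, N * v k := by rw [← Finset.mul_sum, hsum, mul_one]
      _ ≤ _ := Finset.sum_le_sum fun k _ => Nat.le_ceil _
  have hupp : ∑ k, (⌈N * v k⌉₊ : ℝ) ≤ N + r :=
    calc ∑ k, (⌈N * v k⌉₊ : ℝ) ≤ ∑ k : Fin r, (N * v k + 1) := Finset.sum_le_sum fun k _ =>
          (Nat.ceil_lt_add_one (mul_pos hN0 (hpos k)).le).le
      _ = N + r := by simp [Finset.sum_add_distrib, ← Finset.mul_sum, hsum]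
  have hi1 := Nat.le_ceil (N * v i)
  have hi2 := Nat.ceil_lt_add_one (mul_pos hN0 (hpos i)).le
  have hvi : v i ≤ 1 := hsum ▸ Finset.single_le_sum (fun k _ => (hpos k).le) (Finset.mem_univ i)
  set s := ∑ k, (⌈N * v k⌉₊ : ℝ)
  have h1 : N * v i ≤ s * v i := mul_le_mul_of_nonneg_right hlow (hpos i).le
  have h2 : (s - N) * v i ≤ r * 1 :=
    mul_le_mul (by linarith) hvi (hpos i).le (Nat.cast_nonneg r)
  have h3 : ε * N ≤ ε * s := mul_le_mul_of_nonneg_left hlow hε.le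
  have h4 : (0 : ℝ) ≤ r := Nat.cast_nonneg r
  rw [abs_lt]
  constructor <;> linarith

theorem exists_brun_isPFEigenvector_dist_lt {r : ℕ} (hr : 2 ≤ r) {v : Fin r → ℝ}
    (hv : v ∈ l1Simplex r) {ε : ℝ} (hε : 0 < ε) :
    ∃ (A : Matrix (Fin r) (Fin r) ℝ) (u : Fin r → ℝ), IsBrunMatrix A ∧ IsPFEigenvector A u ∧
      dist u v < ε := by
  have : NeZero r := ⟨by omega⟩
  obtain ⟨y, hy⟩ := exists_natCast_mem_coneAround hv hε
  obtain ⟨B, a, b, d, hB, hd, hyB⟩ := exists_admissibleProduct_smul_col hr (y := y)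
    ⟨0, Nat.cast_pos.1 (hy 0).1⟩
  have hb : B.col b ∈ coneAround v ε := by
    rw [← inv_smul_smul₀ hd.ne' (B.col b), ← hyB]
    exact smul_mem_coneAround _ (inv_pos.2 hd) _ hy
  obtain ⟨A, i, j, hA, hcol⟩ := hB.exists_forall_col_mem (isOpen_coneAround v ε)
    smul_mem_coneAround Finset.univ (by simp) hb
  have hApos : IsPositiveMatrix A := fun i j => (hcol j i).1
  obtain ⟨u, hu, ρ, hρ, hAu⟩ := hApos.exists_isPFEigenvector
  refine ⟨A, u, hA.isBrunMatrix, hu, (dist_pi_lt_iff hε).2 fun k => ?_⟩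
  -- The eigenvector is a positive multiple of its image under `A`.
  have hmem : u ∈ coneAround v ε := by
    rw [← inv_smul_smul₀ hρ.ne' u, ← hAu]
    exact smul_mem_coneAround _ (inv_pos.2 hρ) _ (mulVec_mem_coneAround hcol hu.pos)
  simpa [hu.sum_eq_one, Real.dist_eq] using (hmem k).2

theorem IsPFEigenvector.mem_l1Simplex {r : ℕ} {A : Matrix (Fin r) (Fin r) ℝ} {u : Fin r → ℝ}
    (hu : IsPFEigenvector A u) : u ∈ l1Simplex r := by
  refine ⟨hu.pos, ?_⟩
  rw [← hu.sum_eq_one]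
  exact Finset.sum_congr rfl fun i _ => abs_of_pos (hu.pos i)

theorem theoremD (r : ℕ) (hr : 2 ≤ r) :
    Dense {v : l1Simplex r | ∃ Φ : MulAut (FreeGroup (Fin r)),
      IsPositiveAut Φ ∧ IsPFEigenvector (transitionMatrix Φ) (v : Fin r → ℝ)} ∧
    Dense {v : l1Simplex r | ∃ Φ : MulAut (FreeGroup (Fin r)),
      IsPositiveAut Φ ∧ IsBrunMatrix (transitionMatrix Φ) ∧
        IsPFEigenvector (transitionMatrix Φ) (v : Fin r → ℝ)} := by
  have key : Dense {v : l1Simplex r | ∃ Φ : MulAut (FreeGroup (Fin r)),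
      IsPositiveAut Φ ∧ IsBrunMatrix (transitionMatrix Φ) ∧
        IsPFEigenvector (transitionMatrix Φ) (v : Fin r → ℝ)} := by
    refine Metric.dense_iff.2 fun v ε hε => ?_
    obtain ⟨A, u, hA, hu, hdist⟩ := exists_brun_isPFEigenvector_dist_lt hr v.2 hε
    obtain ⟨x, hx, hxA⟩ := hA
    obtain ⟨Φ, hΦ, rfl⟩ := hxA.exists_positiveAut
    exact ⟨⟨u, hu.mem_l1Simplex⟩, Metric.mem_ball.2 hdist, Φ, hΦ, ⟨x, hx, hxA⟩, hu⟩
  refine ⟨key.mono ?_, key⟩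
  rintro v ⟨Φ, hΦ, -, hv⟩
  exact ⟨Φ, hΦ, hv⟩
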